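/- **Theorem (Sphere bouquet theorem).** For $n\ge 2$ let $G_n=\overline{C_n}$ be the graph complement of the cyclic graph $C_n$ on $n$ vertices (where $C_2=K_2$ and $C_3=K_3$), and let $|G|$ denote the geometric realization of the Whitney (clique) complex of a finite simple graph $G$. Call a finite simple graph *contractible* if it is a one-point graph or, inductively, if it has a vertex $x$ such that the unit sphere $S(x)$ (the subgraph induced by the neighbors of $x$) and $G-x$ are both contractible. Call two finite simple graphs *homotopic* if one is obtained from the other, up to isomorphism, by finitely many steps, each of which deletes a vertex whose unit sphere is contractible, or is the reverse of such a deletion. Let the $d$-sphere graph be the graph of the $(d+1)$-dimensional cross polytope, that is, the complement of $d+1$ disjoint edges; let the wedge sum of two such graphs be obtained by identifying one vertex of the first with one vertex of the second; and let the suspension of a graph be its join with the graph that has two vertices and no edge. Then: 1. For every integer $d\ge 0$, the graph $G_{3d+3}$ is homotopic to a wedge sum of two $d$-sphere graphs, and $|G_{3d+3}|$ is homotopy equivalent to the wedge sum $\mathbb{S}^d\vee\mathbb{S}^d$. 2. For every integer $d\ge 0$, the graphs $G_{3d+2}$ and $G_{3d+4}$ are both homotopic to the $d$-sphere graph, and $|G_{3d+2}|$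 and $|G_{3d+4}|$ are both homotopy equivalent to $\mathbb{S}^d$. 3. For every $n\ge 2$, the graph $G_{n+3}$ is homotopic to the suspension $\Sigma G_n$ of $G_n$, and $|G_{n+3}|$ is homotopy equivalent to $|\Sigma G_n|$. -/

import Mathlib

namespace SphereBouquet

/-! ### Finite simple graphs -/

/-- The graph complement `G_n` of the cyclic graph `C_n`. -/
def cycleComplement (n : ℕ) : SimpleGraph (Fin n) := (SimpleGraph.cycleGraph n)ᶜ

/-- The unit sphere `S(x)` of a vertex `x`: the subgraph induced by the vertices adjacent
to `x`. -/
abbrev unitSphere {V : Type} (G : SimpleGraph V) (x : V) : SimpleGraph (G.neighborSet x) :=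
  G.induce (G.neighborSet x)

/-- The graph obtained from `G` by deleting the vertex `x` and all edges at `x`. -/
abbrev deleteVertex {V : Type} (G : SimpleGraph V) (x : V) :
    SimpleGraph ({x}ᶜ : Set V) :=
  G.induce {x}ᶜ

/-- Contractible graphs: a graph is contractible if it is a one-point graph, or if it has a vertex
`x` such that the unit sphere `S(x)` and the graph without `x` are both contractible. -/
inductive IsContractible : ∀ {V : Type}, SimpleGraph V → Prop
  | point {V : Type} [Unique V] (G : SimpleGraph V) : IsContractible G
  | step {V : Type} (G : SimpleGraph V) (x : V) :
      IsContractible (unitSphere G x) → IsContractible (deleteVertex G x) → IsContractible G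

/-- Homotopy of finite simple graphs: the equivalence relation generated by isomorphism and by
homotopy reductions, which delete a vertex whose unit sphere is contractible. The reverse of a
reduction is a homotopy extension, which adds a new vertex joined to a contractible subgraph. -/
inductive GraphHomotopic : ∀ {V W : Type}, SimpleGraph V → SimpleGraph W → Prop
  | iso {V W : Type} {G : SimpleGraph V} {H : SimpleGraph W} :
      (G ≃g H) → GraphHomotopic G H
  | reduction {V : Type} (G : SimpleGraph V) (x : V) :
      IsContractible (unitSphere G x) → GraphHomotopic G (deleteVertex G x)
  | symm {V W : Type} {G : SimpleGraph V} {H : SimpleGraph W} :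
      GraphHomotopic G H → GraphHomotopic H G
  | trans {U V W : Type} [Finite V] {F : SimpleGraph U} {G : SimpleGraph V} {H : SimpleGraph W} :
      GraphHomotopic F G → GraphHomotopic G H → GraphHomotopic F H

/-- The (Zykov) join of two graphs: the disjoint union together with all edges between the two
parts. -/
def join {V W : Type} (G : SimpleGraph V) (H : SimpleGraph W) : SimpleGraph (V ⊕ W) where
  Adj
    | Sum.inl a, Sum.inl b => G.Adj a b
    | Sum.inr a, Sum.inr b => H.Adj a b
    | Sum.inl _, Sum.inr _ => True
    | Sum.inr _, Sum.inl _ => True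
  symm.symm
    | Sum.inl _, Sum.inl _, h => h.symm
    | Sum.inr _, Sum.inr _, h => h.symm
    | Sum.inl _, Sum.inr _, _ => trivial
    | Sum.inr _, Sum.inl _, _ => trivial
  loopless.irrefl
    | Sum.inl a, h => G.irrefl (v := a) h
    | Sum.inr a, h => H.irrefl (v := a) h

/-- The suspension of a graph: the join with the two-point graph without edges. -/
abbrev suspension {V : Type} (G : SimpleGraph V) : SimpleGraph (V ⊕ Bool) :=
  join G (⊥ : SimpleGraph Bool)

/-- The graph of the `(d + 1)`-dimensional cross polytope, the standard `d`-sphere among graphs: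
the `2 * (d + 1)` vertices `(i, ±)`, where two vertices are adjacent unless they are equal or
antipodal. Its clique complex is the boundary complex of the cross polytope. -/
def crossPolytope (d : ℕ) : SimpleGraph (Fin (d + 1) × Bool) where
  Adj a b := a.1 ≠ b.1
  symm.symm _ _ h := h.symm
  loopless.irrefl _ h := h rfl

/-- The wedge sum of two graphs: the disjoint union of `G` and `H` with the vertex `w` of `H`
identified with the vertex `v` of `G`. The vertices are those of `G` (among them the common vertex
`v`) and those of `H` other than `w`. -/
def wedgeGraph {V W : Type} (G : SimpleGraph V) (v : V) (H : SimpleGraph W) (w : W) :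
    SimpleGraph (V ⊕ {y : W // y ≠ w}) where
  Adj
    | Sum.inl a, Sum.inl b => G.Adj a b
    | Sum.inr a, Sum.inr b => H.Adj a b
    | Sum.inl a, Sum.inr b => a = v ∧ H.Adj w b
    | Sum.inr a, Sum.inl b => b = v ∧ H.Adj w a
  symm.symm
    | Sum.inl _, Sum.inl _, h => h.symm
    | Sum.inr _, Sum.inr _, h => h.symm
    | Sum.inl _, Sum.inr _, h => h
    | Sum.inr _, Sum.inl _, h => h
  loopless.irrefl
    | Sum.inl a, h => G.irrefl (v := a) h
    | Sum.inr a, h => H.irrefl (v := a.1) h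

/-- The wedge sum of two `d`-spheres, as a graph. -/
abbrev crossPolytopeWedge (d : ℕ) :
    SimpleGraph ((Fin (d + 1) × Bool) ⊕ {y : Fin (d + 1) × Bool // y ≠ (0, true)}) :=
  wedgeGraph (crossPolytope d) (0, true) (crossPolytope d) (0, true)

/-! ### Topological spaces -/

/-- The Whitney (clique) complex of a graph: its faces are the vertex sets of the non-empty complete
subgraphs. -/
def whitneyComplex {V : Type} (G : SimpleGraph V) : AbstractSimplicialComplex V where
  faces := {s | s.Nonempty ∧ G.IsClique (s : Set V)}
  isRelLowerSet_faces := fun _ hs =>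
    ⟨hs.1, fun _ hts ht => ⟨ht, hs.2.subset (Finset.coe_subset.mpr hts)⟩⟩
  singleton_mem v := ⟨Finset.singleton_nonempty v, by simp⟩

/-- The geometric realization of a finite abstract simplicial complex: the set of all points of the
standard simplex on the vertex set whose support is contained in a face, with the topology of a
subspace of Euclidean space. -/
abbrev Realization {V : Type} [Fintype V] (K : AbstractSimplicialComplex V) : Type :=
  {x : V → ℝ // x ∈ stdSimplex ℝ V ∧ ∃ s ∈ K.faces, ∀ v, x v ≠ 0 → v ∈ s}

/-- The space of a finite simple graph: the geometric realization of its Whitney complex. -/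
abbrev space {V : Type} [Fintype V] (G : SimpleGraph V) : Type :=
  Realization (whitneyComplex G)

/-- The `d`-dimensional unit sphere in `ℝ^(d+1)` with the Euclidean norm. -/
abbrev Sphere (d : ℕ) : Type :=
  Metric.sphere (0 : EuclideanSpace ℝ (Fin (d + 1))) 1

/-- The base point `(1, 0, …, 0)` of the `d`-sphere. -/
noncomputable def Sphere.base (d : ℕ) : Sphere d := ⟨EuclideanSpace.single 0 1, by simp⟩

/-- The wedge sum of two pointed topological spaces: the quotient of their disjoint union that
identifies the two base points, with the quotient topology. -/
abbrev Wedge {X Y : Type} [TopologicalSpace X] [TopologicalSpace Y] (x : X) (y : Y) : Type :=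
  Quot fun a b : X ⊕ Y => a = Sum.inl x ∧ b = Sum.inr y

end SphereBouquet

namespace SphereBouquet
open ContinuousMap

/-! The heart of the matter is that $G_{n+3}$ deforms to the suspension of $G_n$
(`cycleComplement_add_three`): removing one edge, adding another and deleting a vertex turns three
consecutive vertices of the cycle into two poles. Induction in steps of three then leaves $G_2$,
$G_3$, $G_4$, which are two points, three points and two disjoint edges. On the other side, the
suspension of a cross polytope is the next cross polytope, and suspension commutes with wedge sums
up to deformation (`FoldEquiv.wedge_suspension`).

Graph homotopy and homotopy equivalence of spaces are obtained together from the relation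
`FoldEquiv`. Its moves ask for cones instead of arbitrary contractible spheres, so each can be
checked on adjacencies alone. The moves are graph homotopies (`FoldEquiv.graphHomotopic`), induce
homotopy equivalences by explicit formulas (`FoldEquiv.homotopyEquiv`), and survive joins
(`FoldEquiv.join`), which the induction needs.

It remains to identify the models: radial projection maps the sphere homeomorphically onto the space
of the cross polytope (`sphereHomeomorph`), and gluing two spaces at a vertex gives the space of the
wedge graph (`nonempty_wedge_homeomorph`). -/

/-- The equivalence relation on graphs generated by isomorphisms, deletions of dominated vertices,
and deletions of edges whose common link is a cone. -/
inductive FoldEquiv : ∀ {V W : Type}, SimpleGraph V → SimpleGraph W → Prop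
  | iso {V W : Type} {G : SimpleGraph V} {H : SimpleGraph W} : (G ≃g H) → FoldEquiv G H
  | vertex {V : Type} (G : SimpleGraph V) (x y : V) (hxy : G.Adj x y)
      (h : ∀ z, G.Adj x z → z ≠ y → G.Adj y z) : FoldEquiv G (deleteVertex G x)
  | edge {V : Type} (G : SimpleGraph V) (x z y : V) (hxz : G.Adj x z) (hx : G.Adj x y)
      (hz : G.Adj z y) (h : ∀ t, G.Adj x t → G.Adj z t → t ≠ y → G.Adj y t) :
      FoldEquiv G (G.deleteEdges {s(x, z)})
  | symm {V W : Type} {G : SimpleGraph V} {H : SimpleGraph W} : FoldEquiv G H → FoldEquiv H G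
  | trans {U V W : Type} [Finite V] {F : SimpleGraph U} {G : SimpleGraph V} {H : SimpleGraph W} :
      FoldEquiv F G → FoldEquiv G H → FoldEquiv F H

/-! ### Fold equivalent graphs are homotopic -/

/-- For any vertex `x` other than the apex, both the unit sphere of `x` and the graph without `x`
are smaller cones with the same apex. -/
theorem isContractible_of_cone {V : Type} [Finite V] (G : SimpleGraph V) (y : V)
    (h : ∀ z, z ≠ y → G.Adj y z) : IsContractible G := by
  induction hn : Nat.card V using Nat.strong_induction_on generalizing V with
  | _ n ih =>
    by_cases hs : ∀ z, z = y
    · have : Unique V := ⟨⟨y⟩, hs⟩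
      exact .point G
    · push Not at hs
      obtain ⟨x, hx⟩ := hs
      have key (s : Set V) (hxs : x ∉ s) (hy : y ∈ s) : IsContractible (G.induce s) := by
        refine ih (Nat.card s) ?_ (G.induce s) ⟨y, hy⟩ ?_ rfl
        · rw [← hn]
          exact Finite.card_subtype_lt hxs
        · rintro ⟨z, hz⟩ hzy
          exact h z (by simpa using hzy)
      exact .step G x (key _ (by simp) (h x hx).symm) (key _ (by simp) (by simpa using hx.symm))

/-- The graph `G` with a new vertex joined to `x` and to all neighbors of `x` except `z`. -/
def cloneAvoiding {V : Type} (G : SimpleGraph V) (x z : V) : SimpleGraph (Option V) where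
  Adj
    | some a, some b => G.Adj a b
    | none, some b => (b = x ∨ G.Adj x b) ∧ b ≠ z
    | some a, none => (a = x ∨ G.Adj x a) ∧ a ≠ z
    | none, none => False
  symm.symm
    | some _, some _, h => h.symm
    | none, some _, h => h
    | some _, none, h => h
    | none, none, h => h
  loopless.irrefl
    | some a, h => G.irrefl (v := a) h
    | none, h => h

/-- An edge is removed by replacing its end `x` with a copy that does not see `z`: the copy is added
first, then the original `x` is deleted. -/
theorem graphHomotopic_deleteEdge {V : Type} [Finite V] (G : SimpleGraph V) (x z y : V)
    (hxz : G.Adj x z) (hx : G.Adj x y) (hz : G.Adj z y)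
    (h : ∀ t, G.Adj x t → G.Adj z t → t ≠ y → G.Adj y t) :
    GraphHomotopic G (G.deleteEdges {s(x, z)}) := by
  classical
  let K := cloneAvoiding G x z
  have h1 : GraphHomotopic K (deleteVertex K none) := by
    refine .reduction K none (isContractible_of_cone _ ⟨some x, Or.inl rfl, hxz.ne⟩ ?_)
    rintro ⟨_ | t, ht⟩ hne
    · exact ht.elim
    · rcases ht.1 with rfl | ht'
      · exact absurd rfl hne
      · exact ht'
  have i1 : deleteVertex K none ≃g G :=
    { toFun := fun t => t.1.get (Option.isSome_iff_ne_none.2 t.2)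
      invFun := fun v => ⟨some v, by simp⟩
      left_inv := fun t => by simp
      right_inv := fun v => by simp
      map_rel_iff' := by
        rintro ⟨_ | a, ha⟩ ⟨_ | b, hb⟩
        · exact absurd rfl ha
        · exact absurd rfl ha
        · exact absurd rfl hb
        · exact Iff.rfl }
  have h2 : GraphHomotopic K (deleteVertex K (some x)) := by
    -- Inside the unit sphere of `x`, the sphere of `z` misses the copy and is a cone with apex `y`;
    -- after removal of `z`, the rest is a cone with apex the copy.
    refine .reduction K (some x) (.step _ ⟨some z, hxz⟩ ?_ ?_)
    · refine isContractible_of_cone _ ⟨⟨some y, hx⟩, hz⟩ ?_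
      rintro ⟨⟨_ | t, ht⟩, ht'⟩ hne
      · exact absurd rfl (And.right ht')
      · exact h t ht ht' (by rintro rfl; exact hne rfl)
    · refine isContractible_of_cone _ ⟨⟨none, Or.inl rfl, hxz.ne⟩, fun h => nomatch congrArg Subtype.val h⟩ ?_
      rintro ⟨⟨_ | t, ht⟩, ht'⟩ hne
      · exact absurd rfl hne
      · exact ⟨Or.inr ht, by rintro rfl; exact ht' rfl⟩
  have i2 : deleteVertex K (some x) ≃g G.deleteEdges {s(x, z)} :=
    { toFun := fun t => t.1.getD x
      invFun := fun v => if hv : v = x then ⟨none, by simp⟩ else ⟨some v, by simpa using hv⟩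
      left_inv := by
        rintro ⟨_ | a, ha⟩
        · simp
        · have : a ≠ x := by simpa using ha
          simp [this]
      right_inv := fun v => by
        by_cases hv : v = x <;> simp [hv]
      map_rel_iff' := by
        rintro ⟨_ | a, ha⟩ ⟨_ | b, hb⟩
        · simp [K, cloneAvoiding]
        · have : b ≠ x := by simpa using hb
          have := hxz.ne
          simp [K, cloneAvoiding]
          grind
        · have : a ≠ x := by simpa using ha
          have := hxz.ne
          simp [K, cloneAvoiding, G.adj_comm a x]
          grind
        · have : a ≠ x := by simpa using ha
          have : b ≠ x := by simpa using hb
          simp [K, cloneAvoiding]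
          grind }
  exact .trans (.symm (.iso i1)) (.trans (.symm h1) (.trans h2 (.iso i2)))

/-- Supplies finiteness of the other end in the `symm` case of inductions over the relation. -/
theorem FoldEquiv.finite_iff {V W : Type} {G : SimpleGraph V} {H : SimpleGraph W}
    (h : FoldEquiv G H) : Finite V ↔ Finite W := by
  induction h with
  | iso e => exact e.toEquiv.finite_iff
  | vertex G x y _ _ =>
    refine ⟨fun _ => inferInstance, fun h => ?_⟩
    have := Set.Finite.union (Set.toFinite ({x}ᶜ : Set _)) (Set.finite_singleton x)
    rw [Set.compl_union_self] at this
    exact Set.finite_univ_iff.1 this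
  | edge => rfl
  | symm _ ih => exact ih.symm
  | trans _ _ ih₁ ih₂ => exact ih₁.trans ih₂

theorem FoldEquiv.graphHomotopic {V W : Type} [Finite V] {G : SimpleGraph V} {H : SimpleGraph W}
    (h : FoldEquiv G H) : GraphHomotopic G H := by
  have hV : Finite V := inferInstance
  induction h with
  | iso e => exact .iso e
  | vertex G x y hxy h =>
    refine .reduction G x (isContractible_of_cone _ ⟨y, hxy⟩ ?_)
    rintro ⟨z, hz⟩ hne
    exact h z hz (by rintro rfl; exact hne rfl)
  | edge G x z y hxz hx hz h => exact graphHomotopic_deleteEdge G x z y hxz hx hz h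
  | symm h ih => exact .symm (ih (h.finite_iff.2 hV))
  | @trans U V' W' hV' _ _ _ h₁ h₂ ih₁ ih₂ => exact .trans (ih₁ hV) (ih₂ hV')

/-! ### Fold equivalence of suspensions -/

/-- The join of two isomorphisms. -/
def joinIso {V V' W W' : Type} {G : SimpleGraph V} {G' : SimpleGraph V'} {H : SimpleGraph W}
    {H' : SimpleGraph W'} (e : G ≃g G') (f : H ≃g H') : join G H ≃g join G' H' where
  toEquiv := Equiv.sumCongr e.toEquiv f.toEquiv
  map_rel_iff' := by
    rintro (a | a) (b | b)
    · exact e.map_adj_iff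
    · exact Iff.rfl
    · exact Iff.rfl
    · exact f.map_adj_iff

/-- Each move keeps its apex `y`: the new vertices in a link lie in `K`, and the join makes them all
adjacent to `y`. -/
theorem FoldEquiv.join {V W U : Type} [Finite V] [hU : Finite U] {G : SimpleGraph V} {H : SimpleGraph W}
    (h : FoldEquiv G H) (K : SimpleGraph U) :
    FoldEquiv (join G K) (SphereBouquet.join H K) := by
  have hV : Finite V := inferInstance
  induction h with
  | iso e => exact .iso (joinIso e (.refl))
  | vertex G x y hxy h =>
    refine .trans (.vertex _ (Sum.inl x) (Sum.inl y) hxy ?_) (.iso ?_)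
    rotate_left
    · exact
      { toFun := fun t => match t with
          | ⟨.inl a, ha⟩ => .inl ⟨a, by simpa using ha⟩
          | ⟨.inr b, _⟩ => .inr b
        invFun := fun t => match t with
          | .inl a => ⟨.inl a.1, fun h => a.2 (Sum.inl.inj h)⟩
          | .inr b => ⟨.inr b, by simp⟩
        left_inv := by rintro ⟨_ | _, _⟩ <;> rfl
        right_inv := by rintro (_ | _) <;> rfl
        map_rel_iff' := by
          rintro ⟨_ | _, _⟩ ⟨_ | _, _⟩ <;> rfl }
    · rintro (z | z) hz hne
      · exact h z hz (by simpa using hne)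
      · trivial
  | edge G x z y hxz hx hz h =>
    refine .trans (.edge _ (Sum.inl x) (Sum.inl z) (Sum.inl y) hxz hx hz ?_) (.iso ?_)
    rotate_left
    · exact
      { toEquiv := Equiv.refl _
        map_rel_iff' := by
          rintro (_ | _) (_ | _) <;> simp [SphereBouquet.join] }
    · rintro (t | t) hx hz hne
      · exact h t hx hz (by simpa using hne)
      · trivial
  | symm h ih => exact .symm (ih (h.finite_iff.2 hV))
  | @trans U V' W' hV' _ _ _ h₁ h₂ ih₁ ih₂ => exact .trans (ih₁ hV) (ih₂ hV')

/-! ### Fold equivalent graphs have homotopy equivalent spaces -/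

/-- The support is itself the smallest candidate face, nonempty because the coordinates sum to 1.
Membership in the space thus becomes a condition on pairs of vertices. -/
theorem exists_face_iff {V : Type} [Fintype V] (G : SimpleGraph V) {x : V → ℝ}
    (hx : x ∈ stdSimplex ℝ V) :
    (∃ s ∈ (whitneyComplex G).faces, ∀ v, x v ≠ 0 → v ∈ s) ↔
      ∀ u v, x u ≠ 0 → x v ≠ 0 → u ≠ v → G.Adj u v := by
  classical
  constructor
  · rintro ⟨s, ⟨-, hs⟩, h⟩ u v hu hv huv
    exact hs (h u hu) (h v hv) huv
  · intro h
    refine ⟨Finset.univ.filter (x · ≠ 0), ⟨?_, ?_⟩, by simp⟩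
    · by_contra hne
      rw [Finset.not_nonempty_iff_eq_empty, Finset.filter_eq_empty_iff] at hne
      have : ∑ v, x v = 0 := Finset.sum_eq_zero fun v hv => by simpa using hne hv
      rw [hx.2] at this
      exact one_ne_zero this
    · intro u hu v hv huv
      exact h u v (by simpa using hu) (by simpa using hv) huv

namespace space

variable {V W U X : Type} [Fintype V] [Fintype W] [Fintype U] [TopologicalSpace X]
  {G : SimpleGraph V} {H : SimpleGraph W} {K : SimpleGraph U}

/-- A point of the space of a graph, from a point of the simplex with complete support. -/
def mk (x : V → ℝ) (hx : x ∈ stdSimplex ℝ V)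
    (h : ∀ u v, x u ≠ 0 → x v ≠ 0 → u ≠ v → G.Adj u v) : space G :=
  ⟨x, hx, (exists_face_iff G hx).2 h⟩

theorem adj (x : space G) {u v : V} (hu : x.1 u ≠ 0) (hv : x.1 v ≠ 0) (huv : u ≠ v) :
    G.Adj u v :=
  (exists_face_iff G x.2.1).1 x.2.2 u v hu hv huv

/-- The straight-line homotopy stays in the space, since the union of the two supports is a clique.
-/
theorem homotopic_of_support {f g : C(X, space G)}
    (h : ∀ x u v, (f x).1 u ≠ 0 → (g x).1 v ≠ 0 → u ≠ v → G.Adj u v) : f.Homotopic g := by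
  have hmem (p : unitInterval × X) :
      (fun v => (1 - (p.1 : ℝ)) * (f p.2).1 v + p.1 * (g p.2).1 v) ∈ stdSimplex ℝ V :=
    convex_stdSimplex ℝ V (f p.2).2.1 (g p.2).2.1 (sub_nonneg.2 p.1.2.2) p.1.2.1 (by ring)
  refine ⟨⟨⟨fun p => mk _ (hmem p) ?_, ?_⟩, ?_, ?_⟩⟩
  · intro u v hu hv huv
    have key (w : V) (hw : (1 - (p.1 : ℝ)) * (f p.2).1 w + p.1 * (g p.2).1 w ≠ 0) :
        (f p.2).1 w ≠ 0 ∨ (g p.2).1 w ≠ 0 := by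
      by_contra! hc
      simp [hc.1, hc.2] at hw
    rcases key u hu with hu | hu <;> rcases key v hv with hv | hv
    · exact adj _ hu hv huv
    · exact h _ _ _ hu hv huv
    · exact (h _ _ _ hv hu huv.symm).symm
    · exact adj _ hu hv huv
  · refine Continuous.subtype_mk (continuous_pi fun v => ?_) _
    have hf : Continuous fun p : unitInterval × X => (f p.2).1 v :=
      (continuous_apply v).comp (continuous_subtype_val.comp (f.continuous.comp continuous_snd))
    have hg : Continuous fun p : unitInterval × X => (g p.2).1 v :=
      (continuous_apply v).comp (continuous_subtype_val.comp (g.continuous.comp continuous_snd))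
    have ht : Continuous fun p : unitInterval × X => (p.1 : ℝ) :=
      continuous_subtype_val.comp continuous_fst
    exact ((continuous_const.sub ht).mul hf).add (ht.mul hg)
  · intro x
    apply Subtype.ext
    funext v
    simp [mk]
  · intro x
    apply Subtype.ext
    funext v
    simp [mk]

/-- The map of spaces induced by a simplicial map. -/
noncomputable def map (f : V → W) (hf : ∀ a b, G.Adj a b → f a ≠ f b → H.Adj (f a) (f b)) :
    C(space G, space H) where
  toFun x := mk (stdSimplex.map f ⟨x.1, x.2.1⟩).1 (stdSimplex.map f ⟨x.1, x.2.1⟩).2 (by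
    classical
    intro u v hu hv huv
    change FunOnFinite.linearMap ℝ ℝ f x.1 u ≠ 0 at hu
    change FunOnFinite.linearMap ℝ ℝ f x.1 v ≠ 0 at hv
    rw [FunOnFinite.linearMap_apply_apply] at hu hv
    obtain ⟨a, ha, hxa⟩ := Finset.exists_ne_zero_of_sum_ne_zero hu
    obtain ⟨b, hb, hxb⟩ := Finset.exists_ne_zero_of_sum_ne_zero hv
    obtain rfl : f a = u := by simpa using ha
    obtain rfl : f b = v := by simpa using hb
    exact hf a b (adj x hxa hxb fun hab => huv (congrArg f hab)) huv)
  continuous_toFun := Continuous.subtype_mk (continuous_subtype_val.comp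
    ((stdSimplex.continuous_map f).comp (Continuous.subtype_mk continuous_subtype_val _))) _

theorem map_apply [DecidableEq W] (f : V → W)
    (hf : ∀ a b, G.Adj a b → f a ≠ f b → H.Adj (f a) (f b)) (x : space G) (w : W) :
    (map f hf x).1 w = ∑ v with f v = w, x.1 v :=
  FunOnFinite.linearMap_apply_apply ..

theorem map_apply_of_injective (f : V → W) (hinj : Function.Injective f)
    (hf : ∀ a b, G.Adj a b → f a ≠ f b → H.Adj (f a) (f b)) (x : space G) (v : V) :
    (map f hf x).1 (f v) = x.1 v := by
  classical
  rw [map_apply, Finset.sum_eq_single v]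
  · intro a ha hne
    exact absurd (hinj (by simpa using ha)) hne
  · simp

theorem exists_of_map_apply_ne_zero {f : V → W}
    {hf : ∀ a b, G.Adj a b → f a ≠ f b → H.Adj (f a) (f b)} {x : space G} {w : W}
    (h : (map f hf x).1 w ≠ 0) : ∃ v, f v = w ∧ x.1 v ≠ 0 := by
  classical
  rw [map_apply] at h
  obtain ⟨a, ha, hxa⟩ := Finset.exists_ne_zero_of_sum_ne_zero h
  exact ⟨a, by simpa using ha, hxa⟩

theorem map_id (h : ∀ a b, G.Adj a b → id a ≠ id b → G.Adj (id a) (id b)) :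
    map id h = ContinuousMap.id (space G) := by
  refine ContinuousMap.ext fun x => Subtype.ext ?_
  funext v
  exact map_apply_of_injective id Function.injective_id h x v

theorem map_comp (f : V → W) (g : W → U)
    (hf : ∀ a b, G.Adj a b → f a ≠ f b → H.Adj (f a) (f b))
    (hg : ∀ a b, H.Adj a b → g a ≠ g b → K.Adj (g a) (g b))
    (hgf : ∀ a b, G.Adj a b → (g ∘ f) a ≠ (g ∘ f) b → K.Adj ((g ∘ f) a) ((g ∘ f) b)) :
    (map g hg).comp (map f hf) = map (g ∘ f) hgf := by
  refine ContinuousMap.ext fun x => Subtype.ext ?_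
  have h := congrArg Subtype.val (stdSimplex.map_comp_apply f g ⟨x.1, x.2.1⟩)
  exact h

/-- The hypothesis is contiguity of the simplicial maps, phrased for pairs of vertices. -/
theorem map_homotopic (f g : V → W) (hf : ∀ a b, G.Adj a b → f a ≠ f b → H.Adj (f a) (f b))
    (hg : ∀ a b, G.Adj a b → g a ≠ g b → H.Adj (g a) (g b))
    (h : ∀ a b, a = b ∨ G.Adj a b → f a ≠ g b → H.Adj (f a) (g b)) :
    (map f hf).Homotopic (map g hg) := by
  refine homotopic_of_support fun x u v hu hv huv => ?_
  obtain ⟨a, rfl, ha⟩ := exists_of_map_apply_ne_zero hu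
  obtain ⟨b, rfl, hb⟩ := exists_of_map_apply_ne_zero hv
  exact h a b (or_iff_not_imp_left.2 fun hab => adj x ha hb hab) huv

/-- Isomorphic graphs have homeomorphic spaces. -/
noncomputable def homeomorphOfIso (e : G ≃g H) : space G ≃ₜ space H where
  toFun := map e fun _ _ h _ => e.map_adj_iff.2 h
  invFun := map e.symm fun _ _ h _ => e.symm.map_adj_iff.2 h
  left_inv x := by
    refine Subtype.ext (funext fun v => ?_)
    conv_lhs => rw [← e.symm_apply_apply v, map_apply_of_injective _ e.symm.injective,
      map_apply_of_injective _ e.injective]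
  right_inv x := by
    refine Subtype.ext (funext fun v => ?_)
    conv_lhs => rw [← e.apply_symm_apply v, map_apply_of_injective _ e.injective,
      map_apply_of_injective _ e.symm.injective]
  continuous_toFun := ContinuousMap.continuous _
  continuous_invFun := ContinuousMap.continuous _

/-- Sending `x` to the dominating vertex `y` is a simplicial retraction, contiguous to the identity.
-/
theorem homotopyEquiv_deleteVertex (G : SimpleGraph V) (x y : V) (hxy : G.Adj x y)
    (h : ∀ z, G.Adj x z → z ≠ y → G.Adj y z) [Fintype ({x}ᶜ : Set V)] :
    Nonempty (space G ≃ₕ space (deleteVertex G x)) := by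
  classical
  let f : V → ({x}ᶜ : Set V) := fun v => if hv : v = x then ⟨y, hxy.ne'⟩ else ⟨v, hv⟩
  have hfx : f x = ⟨y, hxy.ne'⟩ := by simp [f]
  have hfv (v : V) (hv : v ≠ x) : f v = ⟨v, hv⟩ := by simp [f, hv]
  have hf : ∀ a b, G.Adj a b → f a ≠ f b → (deleteVertex G x).Adj (f a) (f b) := by
    intro a b hab hne
    rcases eq_or_ne a x with rfl | ha
    · rw [hfx, hfv b hab.ne'] at hne ⊢
      exact h b hab fun hb => hne (Subtype.ext hb.symm)
    · rcases eq_or_ne b x with rfl | hb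
      · rw [hfx, hfv a ha] at hne ⊢
        exact (h a hab.symm fun hb => hne (Subtype.ext hb)).symm
      · rw [hfv a ha, hfv b hb]
        exact hab
  have hg : ∀ a b : ({x}ᶜ : Set V), (deleteVertex G x).Adj a b → a.1 ≠ b.1 → G.Adj a.1 b.1 :=
    fun a b hab _ => hab
  refine ⟨⟨map f hf, map Subtype.val hg, ?_, ?_⟩⟩
  · rw [map_comp _ _ _ _ fun a b hab hne => hg _ _ (hf a b hab fun h => hne (congrArg Subtype.val h)) hne,
      ← map_id fun _ _ h _ => h]
    refine map_homotopic _ _ _ _ fun a b hab hne => ?_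
    rcases eq_or_ne a x with rfl | ha
    · simp only [Function.comp_apply, hfx, id] at hne ⊢
      rcases hab with rfl | hab
      · exact hxy.symm
      · exact h b hab hne.symm
    · simp only [Function.comp_apply, hfv a ha, id] at hne ⊢
      exact hab.resolve_left hne
  · have hid : f ∘ Subtype.val = id := by
      funext v
      exact hfv v.1 v.2
    rw [map_comp _ _ _ _ fun a b hab _ => by simpa only [hid, id] using hab]
    simp only [hid, map_id]
    exact .refl _

/-- The deformation pushes points off the edge towards `y`: equal weight is taken from `x` and `z`
until one of them vanishes, and is given to `y`. The support gains at most `y`, which is adjacent to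
everything else in it. -/
theorem homotopyEquiv_deleteEdge (G : SimpleGraph V) (x z y : V) (hxz : G.Adj x z)
    (hx : G.Adj x y) (hz : G.Adj z y) (h : ∀ t, G.Adj x t → G.Adj z t → t ≠ y → G.Adj y t) :
    Nonempty (space G ≃ₕ space (G.deleteEdges {s(x, z)})) := by
  classical
  have hxz' := hxz.ne
  have hx' := hx.ne
  have hz' := hz.ne
  let m (t : space G) : ℝ := min (t.1 x) (t.1 z)
  let r (t : space G) (v : V) : ℝ :=
    t.1 v + m t * (2 * (Pi.single y 1 : V → ℝ) v - (Pi.single x 1 : V → ℝ) v -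
      (Pi.single z 1 : V → ℝ) v)
  have hm (t) : 0 ≤ m t := le_min (t.2.1.1 x) (t.2.1.1 z)
  have hrx (t) : r t x = t.1 x - m t := by
    simp [r, hxz', hx', sub_eq_add_neg]
  have hrz (t) : r t z = t.1 z - m t := by
    simp [r, hxz'.symm, hz', sub_eq_add_neg]
  have hry (t) : r t y = t.1 y + m t * 2 := by
    simp [r, hx'.symm, hz'.symm]
  have hrv (t) (v) (h1 : v ≠ x) (h2 : v ≠ z) (h3 : v ≠ y) : r t v = t.1 v := by
    simp [r, h1, h2, h3]
  have hr (t) : r t ∈ stdSimplex ℝ V := by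
    constructor
    · intro v
      have := t.2.1.1 v
      have := hm t
      by_cases h1 : v = x
      · subst h1; rw [hrx]; exact sub_nonneg.2 (min_le_left _ _)
      by_cases h2 : v = z
      · subst h2; rw [hrz]; exact sub_nonneg.2 (min_le_right _ _)
      by_cases h3 : v = y
      · subst h3; rw [hry]; positivity
      · rwa [hrv t v h1 h2 h3]
    · simp only [r]
      rw [Finset.sum_add_distrib, t.2.1.2, ← Finset.mul_sum, Finset.sum_sub_distrib,
        Finset.sum_sub_distrib, ← Finset.mul_sum]
      simp
      norm_num
  have hsupp (t : space G) (v : V) (hv : r t v ≠ 0) : t.1 v ≠ 0 ∨ v = y ∧ m t ≠ 0 := by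
    have := hm t
    have h1 : m t ≤ t.1 x := min_le_left _ _
    have h2 : m t ≤ t.1 z := min_le_right _ _
    by_cases hvx : v = x
    · subst hvx
      left; intro h0; rw [hrx] at hv; apply hv; linarith
    by_cases hvz : v = z
    · subst hvz
      left; intro h0; rw [hrz] at hv; apply hv; linarith
    by_cases hvy : v = y
    · subst hvy
      by_contra! hc
      rw [hry, hc.1, hc.2 rfl] at hv
      simp at hv
    · rw [hrv t v hvx hvz hvy] at hv
      exact .inl hv
  have hcone (t : space G) (v : V) (hmt : m t ≠ 0) (hv : t.1 v ≠ 0) (hvy : v ≠ y) :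
      G.Adj y v := by
    have hpos : 0 < m t := lt_of_le_of_ne (hm t) hmt.symm
    have h1 : t.1 x ≠ 0 := (hpos.trans_le (min_le_left _ _)).ne'
    have h2 : t.1 z ≠ 0 := (hpos.trans_le (min_le_right _ _)).ne'
    by_cases hvx : v = x
    · exact hvx ▸ hx.symm
    by_cases hvz : v = z
    · exact hvz ▸ hz.symm
    exact h v (t.adj h1 hv (Ne.symm hvx)) (t.adj h2 hv (Ne.symm hvz)) hvy
  have hmix (t : space G) (u v : V) (hu : r t u ≠ 0) (hv : t.1 v ≠ 0) (huv : u ≠ v) :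
      G.Adj u v := by
    rcases hsupp t u hu with hu | ⟨rfl, hmt⟩
    · exact t.adj hu hv huv
    · exact hcone t v hmt hv huv.symm
  have hadj (t : space G) (u v : V) (hu : r t u ≠ 0) (hv : r t v ≠ 0) (huv : u ≠ v) :
      G.Adj u v := by
    rcases hsupp t v hv with hv | ⟨rfl, hmt⟩
    · exact hmix t u v hu hv huv
    · rcases hsupp t u hu with hu | ⟨rfl, hmt'⟩
      · exact (hcone t u hmt hu huv).symm
      · exact absurd rfl huv
  have hmc : Continuous m :=
    ((continuous_apply x).comp continuous_subtype_val).min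
      ((continuous_apply z).comp continuous_subtype_val)
  have hrc : Continuous r := by
    refine continuous_pi fun v => ?_
    have : Continuous fun t : space G => t.1 v := (continuous_apply v).comp continuous_subtype_val
    exact this.add (hmc.mul continuous_const)
  let f : C(space G, space (G.deleteEdges {s(x, z)})) :=
    ⟨fun t => mk (r t) (hr t) fun u v hu hv huv => by
      rw [SimpleGraph.deleteEdges_adj]
      refine ⟨hadj t u v hu hv huv, fun he => ?_⟩
      have : r t x ≠ 0 ∧ r t z ≠ 0 := by
        rcases (by simpa using he : u = x ∧ v = z ∨ u = z ∧ v = x) with ⟨rfl, rfl⟩ | ⟨rfl, rfl⟩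
        · exact ⟨hu, hv⟩
        · exact ⟨hv, hu⟩
      rw [hrx, hrz] at this
      rcases min_choice (t.1 x) (t.1 z) with hc | hc
      · exact this.1 (sub_eq_zero.2 hc.symm)
      · exact this.2 (sub_eq_zero.2 hc.symm), Continuous.subtype_mk hrc _⟩
  have hle : ∀ a b, (G.deleteEdges {s(x, z)}).Adj a b → id a ≠ id b → G.Adj (id a) (id b) :=
    fun a b hab _ => G.deleteEdges_le _ hab
  have hval (t) (v : V) : (map id hle t).1 v = t.1 v :=
    map_apply_of_injective id Function.injective_id hle t v
  refine ⟨⟨f, map id hle, ?_, ?_⟩⟩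
  · refine homotopic_of_support fun t u v hu hv huv => ?_
    rw [ContinuousMap.comp_apply, hval] at hu
    exact hmix t u v hu hv huv
  · have : f.comp (map id hle) = .id _ := by
      refine ContinuousMap.ext fun t => Subtype.ext ?_
      funext v
      -- Without the edge, `x` and `z` cannot both carry weight, so the retraction fixes these
      -- points.
      have hm0 : m (map id hle t) = 0 := by
        simp only [m, hval]
        by_contra hne
        have hpos : 0 < min (t.1 x) (t.1 z) :=
          lt_of_le_of_ne (le_min (t.2.1.1 x) (t.2.1.1 z)) (Ne.symm hne)
        have := t.adj (hpos.trans_le (min_le_left _ _)).ne' (hpos.trans_le (min_le_right _ _)).ne'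
          hxz'
        simp at this
      change r (map id hle t) v = t.1 v
      simp only [r, hm0, hval, zero_mul, add_zero]
    rw [this]

end space

theorem FoldEquiv.homotopyEquiv {V W : Type} {G : SimpleGraph V} {H : SimpleGraph W}
    (h : FoldEquiv G H) : ∀ [Fintype V] [Fintype W], Nonempty (space G ≃ₕ space H) := by
  induction h with
  | iso e => exact ⟨(space.homeomorphOfIso e).toHomotopyEquiv⟩
  | vertex G x y hxy h => exact space.homotopyEquiv_deleteVertex G x y hxy h
  | edge G x z y hxz hx hz h =>
    intro hV hW
    obtain rfl := Subsingleton.elim hV hW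
    exact space.homotopyEquiv_deleteEdge G x z y hxz hx hz h
  | symm h ih => exact ih.map .symm
  | @trans U V' W' hV' _ _ _ h₁ h₂ ih₁ ih₂ =>
    intro _ _
    have := Fintype.ofFinite V'
    obtain ⟨e₁⟩ := ih₁
    obtain ⟨e₂⟩ := ih₂
    exact ⟨e₁.trans e₂⟩

/-! ### Complements of cycles -/

theorem FoldEquiv.edge_of_iff {V : Type} {G H : SimpleGraph V} (x z y : V) (hxz : G.Adj x z)
    (hx : G.Adj x y) (hz : G.Adj z y) (h : ∀ t, G.Adj x t → G.Adj z t → t ≠ y → G.Adj y t)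
    (hH : ∀ u v, H.Adj u v ↔ G.Adj u v ∧ ¬ (u = x ∧ v = z ∨ u = z ∧ v = x)) :
    FoldEquiv G H := by
  have : H = G.deleteEdges {s(x, z)} := by
    ext u v
    simp [hH]
  exact this ▸ .edge G x z y hxz hx hz h

/-- With the wraparound spelled out over `ℕ`, later adjacency checks become linear arithmetic. -/
theorem cycleComplement_adj {n : ℕ} (i j : Fin n) :
    (cycleComplement n).Adj i j ↔ (i : ℕ) ≠ j ∧ (i : ℕ) + 1 ≠ j ∧ (j : ℕ) + 1 ≠ i ∧
      ¬ ((i : ℕ) = 0 ∧ (j : ℕ) + 1 = n) ∧ ¬ ((j : ℕ) = 0 ∧ (i : ℕ) + 1 = n) := by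
  rw [cycleComplement, SimpleGraph.compl_adj, SimpleGraph.cycleGraph_adj', ne_eq, Fin.ext_iff]
  have hi := i.2
  have hj := j.2
  rcases lt_trichotomy i j with h | rfl | h
  · rw [Fin.coe_sub_iff_lt.2 h, Fin.sub_val_of_le h.le]
    have : (i : ℕ) < j := h
    omega
  · simp
  · rw [Fin.coe_sub_iff_lt.2 h, Fin.sub_val_of_le h.le]
    have : (j : ℕ) < i := h
    omega

/-- The graph `G` with an additional edge. -/
def addEdge {V : Type} (G : SimpleGraph V) (x z : V) (hxz : x ≠ z) : SimpleGraph V where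
  Adj u v := G.Adj u v ∨ u = x ∧ v = z ∨ u = z ∧ v = x
  symm.symm _ _ h := h.imp SimpleGraph.Adj.symm (fun h => h.symm.imp And.symm And.symm)
  loopless.irrefl u h := by
    rcases h with h | ⟨rfl, h⟩ | ⟨rfl, h⟩
    · exact G.irrefl h
    · exact hxz h
    · exact hxz h.symm

/-- Separating `x` from `y` closes the first `n` vertices up to a copy of $G_n$. Joining `x` to `a`
then leaves `b` as the only non-neighbor of `a`, so `a` dominates `c`. Once `c` is gone, `a` and `b`
are adjacent to all of $G_n$ but not to each other: they are the poles. -/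
theorem cycleComplement_add_three (n : ℕ) (hn : 2 ≤ n) :
    FoldEquiv (cycleComplement (n + 3)) (suspension (cycleComplement n)) := by
  let x : Fin (n + 3) := ⟨n - 1, by omega⟩
  let a : Fin (n + 3) := ⟨n, by omega⟩
  let b : Fin (n + 3) := ⟨n + 1, by omega⟩
  let c : Fin (n + 3) := ⟨n + 2, by omega⟩
  let y : Fin (n + 3) := ⟨0, by omega⟩
  have hxa : x ≠ a := by simp only [x, a, ne_eq, Fin.ext_iff]; omega
  let G₁ := (cycleComplement (n + 3)).deleteEdges {s(x, y)}
  let G₂ := addEdge G₁ x a hxa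
  have h₁ (u v) : G₁.Adj u v ↔ (cycleComplement (n + 3)).Adj u v ∧
      ¬ ((u : ℕ) + 1 = n ∧ (v : ℕ) = 0 ∨ (u : ℕ) = 0 ∧ (v : ℕ) + 1 = n) := by
    simp only [G₁, x, y, SimpleGraph.deleteEdges_adj, Set.mem_singleton_iff, Sym2.eq_iff,
      Fin.ext_iff]
    refine and_congr_right fun _ => ?_
    omega
  have h₂ (u v) : G₂.Adj u v ↔ G₁.Adj u v ∨
      ((u : ℕ) + 1 = n ∧ (v : ℕ) = n ∨ (u : ℕ) = n ∧ (v : ℕ) + 1 = n) := by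
    simp only [G₂, x, a, addEdge, Fin.ext_iff]
    refine or_congr_right ?_
    omega
  have e₁ : FoldEquiv (cycleComplement (n + 3)) G₁ := by
    -- For `n = 2` the vertices `x` and `y` are consecutive, so there is no edge to remove.
    rcases hn.eq_or_lt with rfl | hn
    · have : G₁ = cycleComplement (2 + 3) := by
        ext u v
        rw [h₁, cycleComplement_adj]
        omega
      rw [this]
      exact .iso .refl
    -- The non-neighbors `a` and `c` of the apex `b` are excluded from the common link, by `x` and
    -- `y` respectively.
    · refine .edge _ x y b ?_ ?_ ?_ fun t => ?_
      rotate_right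
      on_goal 1 => have ht := t.2
      all_goals
        simp only [cycleComplement_adj, ne_eq, Fin.ext_iff, x, y, b, true_and]
        omega
  have e₂ : FoldEquiv G₂ G₁ := by
    -- The apex is `c`: its non-neighbor `b` is not adjacent to `a`, and its non-neighbor `y` is no
    -- longer adjacent to `x`.
    refine .edge_of_iff x a c ?_ ?_ ?_ (fun t => ?_) fun u v => ?_
    on_goal 4 => have ht := t.2
    on_goal 5 => have hu := u.2; have hv := v.2
    all_goals
      simp only [h₂, h₁, cycleComplement_adj, ne_eq, Fin.ext_iff, x, a, c, true_and, and_true]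
      omega
  have e₃ : FoldEquiv G₂ (deleteVertex G₂ c) := by
    refine .vertex G₂ c a ?_ fun t => ?_
    on_goal 2 => have ht := t.2
    all_goals
      simp only [h₂, h₁, cycleComplement_adj, ne_eq, Fin.ext_iff, a, c, true_and, and_true]
      omega
  let f : Fin n ⊕ Bool → ({c}ᶜ : Set (Fin (n + 3))) := fun t => match t with
    | .inl i => ⟨⟨i, by omega⟩, by
        simp only [c, Set.mem_compl_iff, Set.mem_singleton_iff, Fin.ext_iff]; omega⟩
    | .inr true => ⟨a, by simp [a, c]⟩
    | .inr false => ⟨b, by simp [b, c]⟩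
  have hl (i) : ((f (.inl i)).1 : ℕ) = i := rfl
  have ht : ((f (.inr true)).1 : ℕ) = n := rfl
  have hf : ((f (.inr false)).1 : ℕ) = n + 1 := rfl
  have hbij : Function.Bijective f := by
    constructor
    · intro s t hst
      have hst : ((f s).1 : ℕ) = (f t).1 := by rw [hst]
      rcases s with i | (_ | _) <;> rcases t with j | (_ | _) <;>
        simp only [hl, ht, hf] at hst <;>
        first | rfl | omega | exact congrArg Sum.inl (Fin.ext hst)
    · rintro ⟨i, hi⟩
      have hi' := i.2
      have hi : (i : ℕ) ≠ n + 2 := by simpa [c, Fin.ext_iff] using hi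
      rcases lt_trichotomy (i : ℕ) n with h | h | h
      · exact ⟨.inl ⟨i, h⟩, rfl⟩
      · exact ⟨.inr true, Subtype.ext (Fin.ext h.symm)⟩
      · exact ⟨.inr false, Subtype.ext (Fin.ext (show n + 1 = (i : ℕ) by omega))⟩
  have e₄ : suspension (cycleComplement n) ≃g deleteVertex G₂ c :=
    { toEquiv := Equiv.ofBijective f hbij
      map_rel_iff' := by
        intro s t
        change G₂.Adj (f s).1 (f t).1 ↔ _
        rw [h₂, h₁, cycleComplement_adj]
        rcases s with i | (_ | _) <;> rcases t with j | (_ | _)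
        on_goal 1 => have hi := i.2; have hj := j.2
        on_goal 2 => have hi := i.2
        on_goal 3 => have hi := i.2
        on_goal 4 => have hj := j.2
        on_goal 7 => have hj := j.2
        all_goals
          simp only [hl, ht, hf, suspension, join, cycleComplement_adj, SimpleGraph.bot_adj,
            iff_true, iff_false, true_and, and_true]
          omega }
  exact .trans e₁ (.trans (.symm e₂) (.trans e₃ (.symm (.iso e₄))))

/-! ### Cross polytopes and their wedge sums -/

theorem crossPolytope_zero : crossPolytope 0 = ⊥ := by
  ext a b
  simpa [crossPolytope] using (Subsingleton.elim (α := Fin 1) a.1 b.1)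

theorem crossPolytopeWedge_zero : crossPolytopeWedge 0 = ⊥ := by
  ext a b
  rcases a with a | a <;> rcases b with b | b <;> simp [wedgeGraph, crossPolytope_zero]

theorem FoldEquiv.bot_of_card_eq {V W : Type} [Fintype V] [Fintype W]
    (h : Fintype.card V = Fintype.card W) :
    FoldEquiv (⊥ : SimpleGraph V) (⊥ : SimpleGraph W) :=
  .iso ⟨Fintype.equivOfCardEq h, by simp⟩

theorem cycleComplement_two : FoldEquiv (cycleComplement 2) (crossPolytope 0) := by
  have : cycleComplement 2 = ⊥ := by
    ext a b
    rw [cycleComplement_adj, SimpleGraph.bot_adj]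
    have := a.2
    have := b.2
    simp only [iff_false]
    omega
  rw [this, crossPolytope_zero]
  exact .bot_of_card_eq (by simp)

theorem cycleComplement_three : FoldEquiv (cycleComplement 3) (crossPolytopeWedge 0) := by
  have : cycleComplement 3 = ⊥ := by
    ext a b
    rw [cycleComplement_adj, SimpleGraph.bot_adj]
    have := a.2
    have := b.2
    simp only [iff_false]
    omega
  rw [this, crossPolytopeWedge_zero]
  exact .bot_of_card_eq (by simp [Fintype.card_subtype_compl])

/-- The graph is the two disjoint edges 0–2 and 1–3; each folds onto one end. -/
theorem cycleComplement_four : FoldEquiv (cycleComplement 4) (crossPolytope 0) := by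
  have hadj (i j : Fin 4) : (cycleComplement 4).Adj i j ↔ (i : ℕ) + 2 = j ∨ (j : ℕ) + 2 = i := by
    rw [cycleComplement_adj]
    omega
  have e₁ : FoldEquiv (cycleComplement 4) (deleteVertex (cycleComplement 4) 0) := by
    refine .vertex _ 0 2 ?_ fun t => ?_
    · simp [hadj]
    · simp only [hadj, ne_eq, Fin.ext_iff]
      simp only [Fin.isValue, Fin.val_zero, Fin.val_two]
      omega
  set G := deleteVertex (cycleComplement 4) 0 with hG
  have hG' (u v) : G.Adj u v ↔ (u.1 : ℕ) + 2 = v.1 ∨ (v.1 : ℕ) + 2 = u.1 := hadj u.1 v.1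
  have hpos (u : ({0}ᶜ : Set (Fin 4))) : (u.1 : ℕ) ≠ 0 := fun h => u.2 (Fin.ext h)
  have e₂ : FoldEquiv G (deleteVertex G ⟨1, by simp⟩) := by
    refine .vertex G ⟨1, by simp⟩ ⟨3, by simp⟩ ?_ fun t => ?_
    · simp [hG']
    · simp only [hG', ne_eq, Subtype.ext_iff, Fin.ext_iff]
      have : ((1 : Fin 4) : ℕ) = 1 := rfl
      have : ((3 : Fin 4) : ℕ) = 3 := rfl
      have := hpos t
      omega
  have hbot : deleteVertex G ⟨1, by simp⟩ = ⊥ := by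
    ext u v
    have hu : (u.1.1 : ℕ) ≠ 1 := fun h => u.2 (Subtype.ext (Fin.ext h))
    have hv : (v.1.1 : ℕ) ≠ 1 := fun h => v.2 (Subtype.ext (Fin.ext h))
    have := hpos u.1
    have := hpos v.1
    rw [SimpleGraph.bot_adj, SimpleGraph.comap_adj, hG']
    simp only [Function.Embedding.subtype_apply, iff_false]
    omega
  rw [hbot] at e₂
  rw [crossPolytope_zero]
  refine .trans e₁ (.trans e₂ (.bot_of_card_eq ?_))
  rw [Fintype.card_compl_set, Fintype.card_compl_set]
  simp

/-- The suspension of a cross polytope is a cross polytope. -/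
noncomputable def suspensionCrossPolytope (d : ℕ) :
    suspension (crossPolytope d) ≃g crossPolytope (d + 1) where
  toEquiv := Equiv.ofBijective
    (Sum.elim (fun p => (p.1.castSucc, p.2)) (fun b => (Fin.last (d + 1), b))) (by
      constructor
      · rintro (⟨i, a⟩ | a) (⟨j, b⟩ | b) h
        · simpa using h
        · exact absurd (congrArg Prod.fst h) (Fin.castSucc_ne_last i)
        · exact absurd (congrArg Prod.fst h).symm (Fin.castSucc_ne_last j)
        · simpa using h
      · rintro ⟨i, b⟩
        induction i using Fin.lastCases with
        | last => exact ⟨.inr b, rfl⟩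
        | cast i => exact ⟨.inl (i, b), rfl⟩)
  map_rel_iff' := by
    rintro (⟨i, a⟩ | a) (⟨j, b⟩ | b)
    · exact (Fin.castSucc_injective _).ne_iff
    · exact iff_of_true (Fin.castSucc_ne_last i) trivial
    · exact iff_of_true (Fin.castSucc_ne_last j).symm trivial
    · exact iff_of_false (fun h => h rfl) id

/-- The wedge sum of two isomorphisms. -/
def wedgeIso {V V' W W' : Type} {G : SimpleGraph V} {G' : SimpleGraph V'} {H : SimpleGraph W}
    {H' : SimpleGraph W'} (e : G ≃g G') (f : H ≃g H') (v : V) (w : W) :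
    wedgeGraph G v H w ≃g wedgeGraph G' (e v) H' (f w) where
  toEquiv := Equiv.sumCongr e.toEquiv (f.toEquiv.subtypeEquiv fun a => by simp)
  map_rel_iff' := by
    rintro (a | a) (b | b)
    · exact e.map_adj_iff
    · exact and_congr e.toEquiv.apply_eq_iff_eq f.map_adj_iff
    · exact and_congr e.toEquiv.apply_eq_iff_eq f.map_adj_iff
    · exact f.map_adj_iff

/-- The graph `G` with additional edges from `p` to all vertices of `T`. -/
def addEdges {V : Type} (G : SimpleGraph V) (p : V) (T : Set V) : SimpleGraph V where
  Adj u v := G.Adj u v ∨ u ≠ v ∧ (u = p ∧ v ∈ T ∨ v = p ∧ u ∈ T)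
  symm.symm _ _ h := h.imp SimpleGraph.Adj.symm fun h => ⟨h.1.symm, h.2.symm⟩
  loopless.irrefl _ h := h.elim G.irrefl fun h => h.1 rfl

/-- This prepares a merge of `q` into `p`: afterwards `p` dominates `q`. The edge from `p` to `q`
comes first, with apex `y`, because `q` serves as the apex for all further edges. -/
theorem FoldEquiv.addEdges_neighborSet {V : Type} [Finite V] (G : SimpleGraph V) (p q y : V)
    (hpq : p ≠ q) (hadj : ¬ G.Adj p q) (hp : G.Adj p y) (hq : G.Adj q y)
    (hcone : ∀ t, G.Adj p t → G.Adj q t → t ≠ y → G.Adj y t)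
    (hlink : ∀ b, G.Adj q b → ¬ G.Adj p b → ∀ a, G.Adj p a → G.Adj b a → G.Adj q a) :
    FoldEquiv G (addEdges G p (insert q (G.neighborSet q))) := by
  suffices h : ∀ T ⊆ G.neighborSet q, FoldEquiv G (addEdges G p (insert q T)) from h _ subset_rfl
  intro T hT
  induction T, T.toFinite using Set.Finite.induction_on with
  | empty =>
    refine .symm (.edge_of_iff p q y ?_ (.inl hp) (.inl hq) ?_ ?_)
    · exact .inr ⟨hpq, .inl ⟨rfl, .inl rfl⟩⟩
    · rintro t (h₁ | h₁) (h₂ | h₂) hty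
      · exact .inl (hcone t h₁ h₂ hty)
      all_goals
        simp only [Set.mem_insert_iff, Set.mem_empty_iff_false] at h₁ h₂
        grind [SimpleGraph.irrefl]
    · intro u v
      simp only [addEdges, Set.mem_insert_iff, Set.mem_empty_iff_false]
      grind [SimpleGraph.adj_comm]
  | @insert b T hb _ ih =>
    have hqb : G.Adj q b := hT (Set.mem_insert _ _)
    have hbp : b ≠ p := by rintro rfl; exact hadj hqb.symm
    refine .trans (ih ((Set.subset_insert _ _).trans hT)) ?_
    by_cases hpb : G.Adj p b
    · have : addEdges G p (insert q (insert b T)) = addEdges G p (insert q T) := by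
        ext u v
        simp only [addEdges, Set.mem_insert_iff]
        grind [SimpleGraph.adj_comm]
      rw [this]
      exact .iso .refl
    -- A common neighbor of `p` and `b` is either an old neighbor of `p`, hence adjacent to `q` by
    -- `hlink`, or was joined to `p` as an element of `T`, hence is a neighbor of `q`.
    · refine .symm (.edge_of_iff p b q ?_ ?_ (.inl hqb.symm) ?_ ?_)
      · exact .inr ⟨hbp.symm, .inl ⟨rfl, .inr (.inl rfl)⟩⟩
      · exact .inr ⟨hpq, .inl ⟨rfl, .inl rfl⟩⟩
      · intro t h₁ h₂ htq
        have hbt : t ≠ p → G.Adj b t := by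
          intro htp
          rcases h₂ with h₂ | ⟨-, ⟨h, -⟩ | ⟨h, -⟩⟩
          · exact h₂
          · exact absurd h hbp
          · exact absurd h htp
        rcases h₁ with h₁ | ⟨hpt, ⟨-, h⟩ | ⟨h, -⟩⟩
        · exact .inl (hlink b hqb hpb t h₁ (hbt h₁.ne'))
        · rcases h with h | h
          · exact absurd h htq
          · exact .inl (hT h)
        · exact absurd h.symm hpt
      · intro u v
        have hbq : b ≠ q := hqb.ne'
        simp only [addEdges, Set.mem_insert_iff]
        grind [SimpleGraph.adj_comm]

/-! ### Suspension commutes with wedge sums -/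

section WedgeSuspension

variable {V W : Type} (G : SimpleGraph V) (v : V) (H : SimpleGraph W) (w : W)

/-- The suspension point `b` of the first graph in a wedge sum of two suspensions. -/
abbrev leftPole (b : Bool) : (V ⊕ Bool) ⊕ {y : W ⊕ Bool // y ≠ Sum.inl w} := .inl (.inr b)

/-- The suspension point `b` of the second graph in a wedge sum of two suspensions. -/
abbrev rightPole (b : Bool) : (V ⊕ Bool) ⊕ {y : W ⊕ Bool // y ≠ Sum.inl w} :=
  .inr ⟨.inr b, by simp⟩

variable {G v H w}

theorem leftPole_adj {b : Bool} {t : (V ⊕ Bool) ⊕ {y : W ⊕ Bool // y ≠ Sum.inl w}} :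
    (wedgeGraph (suspension G) (.inl v) (suspension H) (.inl w)).Adj (leftPole w b) t ↔
      ∃ a, t = .inl (.inl a) := by
  rcases t with (a | a) | ⟨a | a, ha⟩ <;> simp [wedgeGraph, join]

theorem rightPole_adj {b : Bool} {t : (V ⊕ Bool) ⊕ {y : W ⊕ Bool // y ≠ Sum.inl w}} :
    (wedgeGraph (suspension G) (.inl v) (suspension H) (.inl w)).Adj (rightPole w b) t ↔
      t = .inl (.inl v) ∨ ∃ a h, t = .inr ⟨.inl a, h⟩ := by
  rcases t with (a | a) | ⟨a | a, ha⟩ <;> simp [wedgeGraph, join]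
  simpa using ha

/-- Such an `s` lies in `H` away from `w`, so its only neighbor in `G` is the wedge point, which
every pole sees. -/
theorem rightPole_adj_of_common_link {b c : Bool}
    {s t : (V ⊕ Bool) ⊕ {y : W ⊕ Bool // y ≠ Sum.inl w}}
    (hs : (wedgeGraph (suspension G) (.inl v) (suspension H) (.inl w)).Adj (rightPole w b) s)
    (hs' : ¬ (wedgeGraph (suspension G) (.inl v) (suspension H) (.inl w)).Adj (leftPole w c) s)
    (ht : (wedgeGraph (suspension G) (.inl v) (suspension H) (.inl w)).Adj (leftPole w c) t)
    (hst : (wedgeGraph (suspension G) (.inl v) (suspension H) (.inl w)).Adj s t) :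
    (wedgeGraph (suspension G) (.inl v) (suspension H) (.inl w)).Adj (rightPole w b) t := by
  obtain ⟨a, rfl⟩ := leftPole_adj.1 ht
  rcases rightPole_adj.1 hs with rfl | ⟨c, h, rfl⟩
  · exact absurd (leftPole_adj.2 ⟨v, rfl⟩) hs'
  · exact rightPole_adj.2 (.inl (congrArg Sum.inl hst.1))

variable (G v H w)

set_option maxHeartbeats 1600000 in
/-- The suspension of a wedge sum is fold equivalent to the wedge sum of the suspensions. -/
theorem FoldEquiv.wedge_suspension [Finite V] [Finite W] :
    FoldEquiv (wedgeGraph (suspension G) (.inl v) (suspension H) (.inl w))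
      (suspension (wedgeGraph G v H w)) := by
  classical
  -- The wedge of suspensions has four poles, the suspension of the wedge only two: each right pole
  -- `q b` is merged into the left pole `p b`. The first new edge of each merge has the wedge point
  -- as apex.
  let K := wedgeGraph (suspension G) (.inl v) (suspension H) (.inl w)
  let p (b : Bool) : (V ⊕ Bool) ⊕ {y : W ⊕ Bool // y ≠ Sum.inl w} := leftPole w b
  let q (b : Bool) : (V ⊕ Bool) ⊕ {y : W ⊕ Bool // y ≠ Sum.inl w} := rightPole w b
  let K₁ := addEdges K (p true) (insert (q true) (K.neighborSet (q true)))
  let K₂ := addEdges K₁ (p false) (insert (q false) (K₁.neighborSet (q false)))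
  have e₁ : FoldEquiv K K₁ := by
    refine .addEdges_neighborSet K (p true) (q true) (.inl (.inl v)) ?_ ?_ ?_ ?_ ?_ ?_
    · simp [p, q]
    · simp [p, q, K, wedgeGraph, suspension, SphereBouquet.join]
    · simp [p, K, wedgeGraph, suspension, SphereBouquet.join]
    · simp [q, K, wedgeGraph, suspension, SphereBouquet.join]
    · rintro ((a | a) | ⟨a | a, ha⟩) <;> simp +contextual [p, q, K, wedgeGraph, suspension, SphereBouquet.join]
    · exact fun s hs hs' t ht hst => rightPole_adj_of_common_link hs hs' ht hst
  have e₂ : FoldEquiv K₁ K₂ := by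
    refine .addEdges_neighborSet K₁ (p false) (q false) (.inl (.inl v)) ?_ ?_ ?_ ?_ ?_ ?_
    · simp [p, q]
    · simp [p, q, K₁, addEdges, K, wedgeGraph, suspension, SphereBouquet.join]
    · simp [p, K₁, addEdges, K, wedgeGraph, suspension, SphereBouquet.join]
    · simp [q, K₁, addEdges, K, wedgeGraph, suspension, SphereBouquet.join]
    · rintro ((a | a) | ⟨a | a, ha⟩) <;>
        simp +contextual [p, q, K₁, addEdges, K, wedgeGraph, suspension, SphereBouquet.join]
    -- The first merge does not change the neighbors of the poles labelled `false`, so the link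
    -- condition can be checked in `K`.
    · have hpole (r t) (hr : r = p false ∨ r = q false) : K₁.Adj r t ↔ K.Adj r t := by
        rcases hr with rfl | rfl <;> rcases t with (a | a) | ⟨a | a, ha⟩ <;>
          simp [p, q, K₁, addEdges, K, wedgeGraph, SphereBouquet.join]
      intro s hs hs' t ht hst
      rw [hpole _ _ (.inl rfl)] at hs' ht
      rw [hpole _ _ (.inr rfl)] at hs ⊢
      refine rightPole_adj_of_common_link hs hs' ht ?_
      obtain ⟨a, rfl⟩ := leftPole_adj.1 ht
      rcases hst with hst | ⟨-, ⟨rfl, -⟩ | ⟨h, -⟩⟩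
      · exact hst
      · simp [K, p, q, rightPole_adj] at hs
      · simp [p] at h
  have e₃ : FoldEquiv K₂ (deleteVertex K₂ (q true)) := by
    refine .vertex K₂ (q true) (p true) ?_ ?_
    · simp [p, q, K₂, K₁, addEdges]
    · rintro ((a | a) | ⟨a | a, ha⟩) <;>
        simp +contextual [p, q, K₂, K₁, addEdges, K, wedgeGraph, suspension, SphereBouquet.join]
  have e₄ : FoldEquiv (deleteVertex K₂ (q true))
      (deleteVertex (deleteVertex K₂ (q true)) ⟨q false, by simp [q]⟩) := by
    refine .vertex (deleteVertex K₂ (q true)) ⟨q false, by simp [q]⟩ ⟨p false, by simp [p, q]⟩ ?_ ?_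
    · simp [p, q, K₂, addEdges]
    · rintro ⟨((a | a) | ⟨a | a, ha⟩), ha'⟩ <;>
        simp +contextual [p, q, K₂, K₁, addEdges, K, wedgeGraph, suspension, SphereBouquet.join]
  let f (t : (V ⊕ {y : W // y ≠ w}) ⊕ Bool) : (V ⊕ Bool) ⊕ {y : W ⊕ Bool // y ≠ Sum.inl w} :=
    match t with
    | .inl (.inl a) => .inl (.inl a)
    | .inl (.inr a) => .inr ⟨.inl a.1, by simpa using a.2⟩
    | .inr b => p b
  have hf (b t) : f t ≠ q b := by
    rcases t with (a | a) | a <;> simp [f, p, q]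
  let f' (t : (V ⊕ {y : W // y ≠ w}) ⊕ Bool) : ({⟨q false, by simp [q]⟩}ᶜ :
      Set ({q true}ᶜ : Set ((V ⊕ Bool) ⊕ {y : W ⊕ Bool // y ≠ Sum.inl w}))) :=
    ⟨⟨f t, hf true t⟩, fun h => hf false t (congrArg Subtype.val h)⟩
  have hbij : Function.Bijective f' := by
    constructor
    · intro s t hst
      have hst : f s = f t := congrArg (fun x => x.1.1) hst
      rcases s with (a | ⟨a, ha⟩) | a <;> rcases t with (b | ⟨b, hb⟩) | b <;>
        simp_all [f, p]
    · rintro ⟨⟨t, h₁⟩, h₂⟩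
      obtain ⟨s, rfl⟩ : ∃ s, f s = t := by
        rcases t with (a | a) | ⟨a | a, ha⟩
        · exact ⟨.inl (.inl a), rfl⟩
        · exact ⟨.inr a, rfl⟩
        · exact ⟨.inl (.inr ⟨a, by simpa using ha⟩), rfl⟩
        · cases a
          · exact absurd rfl h₂
          · exact absurd rfl h₁
      exact ⟨s, rfl⟩
  have e₅ : suspension (wedgeGraph G v H w) ≃g
      deleteVertex (deleteVertex K₂ (q true)) ⟨q false, by simp [q]⟩ :=
    { toEquiv := Equiv.ofBijective f' hbij
      map_rel_iff' := by
        intro s t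
        change K₂.Adj (f s) (f t) ↔ _
        rcases s with (a | ⟨a, ha⟩) | (_ | _) <;> rcases t with (b | ⟨b, hb⟩) | (_ | _) <;>
          simp [f, p, q, K₂, K₁, addEdges, K, wedgeGraph, suspension, SphereBouquet.join] }
  exact .trans e₁ (.trans e₂ (.trans e₃ (.trans e₄ (.symm (.iso e₅)))))

end WedgeSuspension

/-! ### Induction in steps of three -/

theorem FoldEquiv.suspension_crossPolytope (d : ℕ) :
    FoldEquiv (suspension (crossPolytope d)) (crossPolytope (d + 1)) :=
  .iso (suspensionCrossPolytope d)

theorem FoldEquiv.suspension_crossPolytopeWedge (d : ℕ) :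
    FoldEquiv (suspension (crossPolytopeWedge d)) (crossPolytopeWedge (d + 1)) :=
  .trans (.symm (.wedge_suspension ..))
    -- The isomorphism adds the new antipodal pair as the last coordinate, so it keeps the base
    -- vertex `(0, true)`.
    (.iso (wedgeIso (suspensionCrossPolytope d) (suspensionCrossPolytope d) _ _))

theorem FoldEquiv.cycleComplement_crossPolytopeWedge (d : ℕ) :
    FoldEquiv (cycleComplement (3 * d + 3)) (crossPolytopeWedge d) := by
  induction d with
  | zero => exact cycleComplement_three
  | succ d ih =>
    exact .trans (cycleComplement_add_three (3 * d + 3) (by omega))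
      (.trans (ih.join _) (.suspension_crossPolytopeWedge d))

theorem FoldEquiv.cycleComplement_crossPolytope_two (d : ℕ) :
    FoldEquiv (cycleComplement (3 * d + 2)) (crossPolytope d) := by
  induction d with
  | zero => exact cycleComplement_two
  | succ d ih =>
    exact .trans (cycleComplement_add_three (3 * d + 2) (by omega))
      (.trans (ih.join _) (.suspension_crossPolytope d))

theorem FoldEquiv.cycleComplement_crossPolytope_four (d : ℕ) :
    FoldEquiv (cycleComplement (3 * d + 4)) (crossPolytope d) := by
  induction d with
  | zero => exact cycleComplement_four
  | succ d ih =>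
    exact .trans (cycleComplement_add_three (3 * d + 4) (by omega))
      (.trans (ih.join _) (.suspension_crossPolytope d))

/-! ### The space of a cross polytope is a sphere -/

namespace space

/-- The point of the space of a graph given by a vertex. -/
noncomputable def vertex {V : Type} [Fintype V] [DecidableEq V] (G : SimpleGraph V) (v : V) :
    space G :=
  mk (Pi.single v 1) (single_mem_stdSimplex ℝ v) (by
    intro a b ha hb hab
    have ha : a = v := by by_contra h; simp [h] at ha
    have hb : b = v := by by_contra h; simp [h] at hb
    exact absurd (ha.trans hb.symm) hab)

theorem eq_vertex {V : Type} [Fintype V] [DecidableEq V] {G : SimpleGraph V} {v : V}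
    (x : space G) (h : ∀ u, u ≠ v → x.1 u = 0) : x = vertex G v := by
  refine Subtype.ext (funext fun u => ?_)
  change x.1 u = (Pi.single v 1 : V → ℝ) u
  by_cases hu : u = v
  · subst hu
    rw [Pi.single_eq_same, ← x.2.1.2, Finset.sum_eq_single u (fun b _ hb => h b hb) (by simp)]
  · rw [Pi.single_eq_of_ne hu, h u hu]

end space

/-- The sum of the absolute values of the coordinates. -/
def absSum {d : ℕ} (u : EuclideanSpace ℝ (Fin (d + 1))) : ℝ := ∑ i, |u i|

theorem absSum_pos {d : ℕ} (u : Sphere d) : 0 < absSum u.1 := by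
  have hne : u.1 ≠ 0 := by
    intro h
    have := mem_sphere_zero_iff_norm.1 u.2
    simp [h] at this
  obtain ⟨i, hi⟩ : ∃ i, u.1 i ≠ 0 := by
    by_contra! h
    exact hne (PiLp.ext h)
  exact Finset.sum_pos' (fun _ _ => abs_nonneg _) ⟨i, Finset.mem_univ _, abs_pos.2 hi⟩

/-- The barycentric coordinates of the radial projection of a point of the sphere to the cross
polytope. -/
noncomputable def crossCoord {d : ℕ} (u : Sphere d) (p : Fin (d + 1) × Bool) : ℝ :=
  max (if p.2 then u.1 p.1 else -u.1 p.1) 0 / absSum u.1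

/-- Positive part minus negative part recovers the point up to scale; injectivity rests on this. -/
theorem crossCoord_sub {d : ℕ} (u : Sphere d) (i : Fin (d + 1)) :
    crossCoord u (i, true) - crossCoord u (i, false) = u.1 i / absSum u.1 := by
  simp only [crossCoord, if_true, Bool.false_eq_true, if_false, ← sub_div]
  congr 1
  rcases le_total 0 (u.1 i) with h | h
  · simp [h]
  · simp [h]

/-- The radial projection of the sphere to the cross polytope. -/
noncomputable def sphereToCross (d : ℕ) (u : Sphere d) : space (crossPolytope d) :=
  space.mk (crossCoord u)
    ⟨fun p => div_nonneg (le_max_right _ _) (absSum_pos u).le, by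
      rw [Fintype.sum_prod_type]
      simp only [crossCoord, Fintype.sum_bool, if_true, Bool.false_eq_true, if_false, ← add_div]
      rw [← Finset.sum_div, div_eq_one_iff_eq (absSum_pos u).ne', absSum]
      refine Finset.sum_congr rfl fun i _ => ?_
      rcases le_total 0 (u.1 i) with h | h
      · simp [h, abs_of_nonneg h]
      · simp [h, abs_of_nonpos h]⟩ (by
    rintro ⟨i, a⟩ ⟨j, b⟩ h₁ h₂ hne
    change i ≠ j
    rintro rfl
    have h₁ : max (if a then u.1 i else -u.1 i) 0 ≠ 0 := fun h => h₁ (by simp [crossCoord, h])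
    have h₂ : max (if b then u.1 i else -u.1 i) 0 ≠ 0 := fun h => h₂ (by simp [crossCoord, h])
    rcases le_total 0 (u.1 i) with h | h <;> cases a <;> cases b <;> simp_all)

theorem continuous_sphereToCross (d : ℕ) : Continuous (sphereToCross d) := by
  refine Continuous.subtype_mk (continuous_pi fun p => ?_) _
  have hc (i : Fin (d + 1)) : Continuous fun u : Sphere d => u.1 i := by fun_prop
  refine Continuous.div (Continuous.max ?_ continuous_const) ?_ fun u => (absSum_pos u).ne'
  · split_ifs
    · exact hc p.1
    · exact (hc p.1).neg
  · exact continuous_finsetSum _ fun i _ => (hc i).abs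

theorem sphereToCross_injective (d : ℕ) : Function.Injective (sphereToCross d) := by
  intro u v huv
  have hcoord (i) : u.1 i / absSum u.1 = v.1 i / absSum v.1 := by
    have h (p) : crossCoord u p = crossCoord v p := congrFun (congrArg Subtype.val huv) p
    rw [← crossCoord_sub, ← crossCoord_sub, h, h]
  have hsmul : (absSum u.1)⁻¹ • u.1 = (absSum v.1)⁻¹ • v.1 := by
    refine PiLp.ext fun i => ?_
    simpa [div_eq_inv_mul] using hcoord i
  have hnorm := congrArg norm hsmul
  rw [norm_smul, norm_smul, mem_sphere_zero_iff_norm.1 u.2, mem_sphere_zero_iff_norm.1 v.2,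
    mul_one, mul_one, Real.norm_of_nonneg (inv_nonneg.2 (absSum_pos u).le),
    Real.norm_of_nonneg (inv_nonneg.2 (absSum_pos v).le)] at hnorm
  rw [hnorm] at hsmul
  exact Subtype.ext (smul_right_injective _ (inv_ne_zero (absSum_pos v).ne') hsmul)

/-- Antipodal vertices never share a support, so the differences `w` determine `t`, and `w` has
absolute sum 1. Normalizing `w` gives the preimage. -/
theorem sphereToCross_surjective (d : ℕ) : Function.Surjective (sphereToCross d) := by
  intro t
  let w : EuclideanSpace ℝ (Fin (d + 1)) :=
    WithLp.toLp 2 fun i => t.1 (i, true) - t.1 (i, false)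
  have hw (i) : w i = t.1 (i, true) - t.1 (i, false) := rfl
  have hor (i) : t.1 (i, true) = 0 ∨ t.1 (i, false) = 0 := by
    by_contra! h
    exact space.adj t h.1 h.2 (by simp) rfl
  have hnn (p) : 0 ≤ t.1 p := t.2.1.1 p
  have hsum : absSum w = 1 := by
    rw [← t.2.1.2, Fintype.sum_prod_type, absSum]
    refine Finset.sum_congr rfl fun i _ => ?_
    rw [hw, Fintype.sum_bool]
    rcases hor i with h | h
    · rw [h, zero_sub, zero_add, abs_neg, abs_of_nonneg (hnn _)]
    · rw [h, sub_zero, add_zero, abs_of_nonneg (hnn _)]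
  have hne : ‖w‖ ≠ 0 := by
    intro h
    rw [norm_eq_zero] at h
    rw [h] at hsum
    simp [absSum] at hsum
  have hpos : 0 < ‖w‖⁻¹ := inv_pos.2 (lt_of_le_of_ne (norm_nonneg w) hne.symm)
  refine ⟨⟨‖w‖⁻¹ • w, ?_⟩, ?_⟩
  · rw [mem_sphere_zero_iff_norm, norm_smul, norm_inv, norm_norm, inv_mul_cancel₀ hne]
  · refine Subtype.ext (funext fun p => ?_)
    change crossCoord _ p = t.1 p
    have hs : absSum (‖w‖⁻¹ • w) = ‖w‖⁻¹ := by
      simp only [absSum, PiLp.smul_apply, smul_eq_mul, abs_mul, abs_of_pos hpos]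
      rw [← Finset.mul_sum]
      change ‖w‖⁻¹ * absSum w = _
      rw [hsum, mul_one]
    have hmul (x : ℝ) : max (‖w‖⁻¹ * x) 0 / ‖w‖⁻¹ = max x 0 := by
      rw [div_eq_iff hpos.ne', mul_comm _ ‖w‖⁻¹, mul_max_of_nonneg _ _ hpos.le, mul_zero]
    obtain ⟨i, b⟩ := p
    simp only [crossCoord, hs, PiLp.smul_apply, smul_eq_mul, hw, ← mul_neg]
    cases b
    · rw [if_neg (by simp), hmul]
      rcases hor i with h | h <;> simp [h, hnn]
    · rw [if_pos rfl, hmul]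
      rcases hor i with h | h <;> simp [h, hnn]

/-- The sphere is homeomorphic to the space of the cross polytope. -/
noncomputable def sphereHomeomorph (d : ℕ) : Sphere d ≃ₜ space (crossPolytope d) :=
  Continuous.homeoOfEquivCompactToT2
    (f := Equiv.ofBijective _ ⟨sphereToCross_injective d, sphereToCross_surjective d⟩)
    (continuous_sphereToCross d)

theorem sphereHomeomorph_base (d : ℕ) :
    sphereHomeomorph d (Sphere.base d) = space.vertex (crossPolytope d) (0, true) := by
  refine space.eq_vertex _ ?_
  rintro ⟨i, b⟩ hne
  change crossCoord _ _ = 0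
  by_cases hi : i = 0
  · subst hi
    cases b
    · simp [crossCoord, Sphere.base]
    · exact absurd rfl hne
  · simp [crossCoord, Sphere.base, hi]

/-! ### The space of a wedge sum -/

section Wedge

variable {V W : Type} [DecidableEq W] (G : SimpleGraph V) (v : V) (H : SimpleGraph W) (w : W)

/-- The vertex of the wedge sum given by a vertex of the second graph. -/
def wedgeRight (y : W) : V ⊕ {y : W // y ≠ w} := if h : y = w then .inl v else .inr ⟨y, h⟩

variable {v w} in
theorem wedgeRight_self : wedgeRight v w w = .inl v := by simp [wedgeRight]

variable {v w} in
theorem wedgeRight_of_ne {y : W} (h : y ≠ w) : wedgeRight v w y = .inr ⟨y, h⟩ := by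
  simp [wedgeRight, h]

theorem wedgeRight_injective : Function.Injective (wedgeRight v w) := by
  intro a b h
  by_cases ha : a = w <;> by_cases hb : b = w <;> simp_all [wedgeRight]

variable [Fintype V] [Fintype W]

/-- The inclusion of the space of the first graph into the space of the wedge sum. -/
noncomputable def inlMap : C(space G, space (wedgeGraph G v H w)) :=
  space.map Sum.inl fun _ _ h _ => h

/-- The inclusion of the space of the second graph into the space of the wedge sum. -/
noncomputable def inrMap : C(space H, space (wedgeGraph G v H w)) :=
  space.map (wedgeRight v w) fun a b h _ => by
    by_cases ha : a = w
    · subst ha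
      rw [wedgeRight_self, wedgeRight_of_ne h.ne']
      exact ⟨rfl, h⟩
    · by_cases hb : b = w
      · subst hb
        rw [wedgeRight_self, wedgeRight_of_ne ha]
        exact ⟨rfl, h.symm⟩
      · rw [wedgeRight_of_ne ha, wedgeRight_of_ne hb]
        exact h

variable {G v H w}

theorem inlMap_inl (x : space G) (a : V) : (inlMap G v H w x).1 (.inl a) = x.1 a :=
  space.map_apply_of_injective _ Sum.inl_injective _ x a

theorem inlMap_inr (x : space G) (b : {y : W // y ≠ w}) : (inlMap G v H w x).1 (.inr b) = 0 := by
  by_contra h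
  obtain ⟨a, ha, -⟩ := space.exists_of_map_apply_ne_zero h
  cases ha

theorem inrMap_wedgeRight (x : space H) (b : W) :
    (inrMap G v H w x).1 (wedgeRight v w b) = x.1 b :=
  space.map_apply_of_injective _ (wedgeRight_injective v w) _ x b

theorem inrMap_inr (x : space H) (b : {y : W // y ≠ w}) :
    (inrMap G v H w x).1 (.inr b) = x.1 b := by
  rw [← inrMap_wedgeRight (G := G) (v := v) (H := H), wedgeRight_of_ne b.2]

theorem inrMap_inl (x : space H) {a : V} (ha : a ≠ v) : (inrMap G v H w x).1 (.inl a) = 0 := by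
  by_contra h
  obtain ⟨b, hb, -⟩ := space.exists_of_map_apply_ne_zero h
  by_cases hbw : b = w
  · subst hbw
    rw [wedgeRight_self] at hb
    exact ha (Sum.inl.inj hb).symm
  · rw [wedgeRight_of_ne hbw] at hb
    cases hb

theorem inlMap_injective : Function.Injective (inlMap G v H w) := by
  intro x y h
  refine Subtype.ext (funext fun a => ?_)
  rw [← inlMap_inl (v := v) (H := H) (w := w), h, inlMap_inl]

theorem inrMap_injective : Function.Injective (inrMap G v H w) := by
  intro x y h
  refine Subtype.ext (funext fun a => ?_)
  rw [← inrMap_wedgeRight (G := G) (v := v) (w := w), h, inrMap_wedgeRight]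

variable [DecidableEq V]

/-- A common point is supported on the vertices common to both images, that is, on the wedge point
alone. -/
theorem inlMap_eq_inrMap_iff (x : space G) (y : space H) :
    inlMap G v H w x = inrMap G v H w y ↔ x = space.vertex G v ∧ y = space.vertex H w := by
  constructor
  · intro h
    constructor
    · refine space.eq_vertex _ fun a ha => ?_
      rw [← inlMap_inl (v := v) (H := H) (w := w), h, inrMap_inl y ha]
    · refine space.eq_vertex _ fun b hb => ?_
      rw [← inrMap_inr (G := G) (v := v) y ⟨b, hb⟩, ← h, inlMap_inr]
  · rintro ⟨rfl, rfl⟩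
    have h₁ : inlMap G v H w (space.vertex G v) = space.vertex _ (.inl v) := by
      refine space.eq_vertex _ ?_
      rintro (a | b) h
      · rw [inlMap_inl]
        exact Pi.single_eq_of_ne (by rintro rfl; exact h rfl) _
      · exact inlMap_inr _ b
    have h₂ : inrMap G v H w (space.vertex H w) = space.vertex _ (.inl v) := by
      refine space.eq_vertex _ ?_
      rintro (a | b) h
      · exact inrMap_inl _ (by rintro rfl; exact h rfl)
      · rw [inrMap_inr]
        exact Pi.single_eq_of_ne b.2 _
    rw [h₁, h₂]

/-- No edge joins `G` away from `v` to `H` away from `w`, so a clique lies on one side. -/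
theorem exists_inlMap_or_inrMap (z : space (wedgeGraph G v H w)) :
    (∃ x, inlMap G v H w x = z) ∨ ∃ y, inrMap G v H w y = z := by
  by_cases hz : ∀ b, z.1 (.inr b) = 0
  · left
    refine ⟨space.mk (fun a => z.1 (.inl a)) ⟨fun a => z.2.1.1 _, ?_⟩ ?_, ?_⟩
    · have := z.2.1.2
      rw [Fintype.sum_sum_type] at this
      simpa [hz] using this
    · exact fun a b ha hb hab => z.adj ha hb (by simpa using hab)
    · refine Subtype.ext (funext ?_)
      rintro (a | b)
      · rw [inlMap_inl]
        rfl
      · rw [inlMap_inr, hz]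
  · right
    push Not at hz
    obtain ⟨b₀, hb₀⟩ := hz
    have hl (a) (ha : a ≠ v) : z.1 (.inl a) = 0 := by
      by_contra h
      exact ha (z.adj h hb₀ (by simp)).1
    refine ⟨space.mk (fun b => z.1 (wedgeRight v w b)) ⟨fun a => z.2.1.1 _, ?_⟩ ?_, ?_⟩
    · have := z.2.1.2
      rw [Fintype.sum_sum_type, Finset.sum_eq_single v (fun a _ ha => hl a ha) (by simp)] at this
      rw [Fintype.sum_eq_add_sum_subtype_ne _ w, wedgeRight_self, ← this]
      exact congrArg _ (Finset.sum_congr rfl fun b _ => by rw [wedgeRight_of_ne b.2])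
    · intro a b ha hb hab
      have := z.adj ha hb ((wedgeRight_injective v w).ne hab)
      by_cases ha' : a = w
      · subst ha'
        rw [wedgeRight_self, wedgeRight_of_ne hab.symm] at this
        exact this.2
      · by_cases hb' : b = w
        · subst hb'
          rw [wedgeRight_self, wedgeRight_of_ne ha'] at this
          exact this.2.symm
        · rwa [wedgeRight_of_ne ha', wedgeRight_of_ne hb'] at this
    · refine Subtype.ext (funext ?_)
      rintro (a | b)
      · by_cases ha : a = v
        · subst ha
          have h := wedgeRight_self (v := a) (w := w)
          refine (congrArg _ h.symm).trans ((inrMap_wedgeRight _ w).trans ?_)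
          exact congrArg z.1 h
        · rw [inrMap_inl _ ha, hl a ha]
      · rw [inrMap_inr]
        exact congrArg z.1 (wedgeRight_of_ne b.2)

/-- The wedge sum of two compact spaces is homeomorphic to the space of the wedge sum of two graphs,
if they are homeomorphic to the spaces of these graphs. -/
theorem nonempty_wedge_homeomorph {X Y : Type} [TopologicalSpace X] [TopologicalSpace Y]
    [CompactSpace X] [CompactSpace Y] (e : X ≃ₜ space G) (f : Y ≃ₜ space H) {x : X} {y : Y}
    (hx : e x = space.vertex G v) (hy : f y = space.vertex H w) :
    Nonempty (Wedge x y ≃ₜ space (wedgeGraph G v H w)) := by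
  let g : X ⊕ Y → space (wedgeGraph G v H w) :=
    Sum.elim (fun a => inlMap G v H w (e a)) (fun b => inrMap G v H w (f b))
  have hg : Continuous g :=
    ((inlMap G v H w).continuous.comp e.continuous).sumElim
      ((inrMap G v H w).continuous.comp f.continuous)
  have hiff (a : X) (b : Y) : g (.inl a) = g (.inr b) ↔ a = x ∧ b = y := by
    change inlMap G v H w (e a) = inrMap G v H w (f b) ↔ _
    rw [inlMap_eq_inrMap_iff, ← hx, ← hy, e.injective.eq_iff, f.injective.eq_iff]
  let g' : Wedge x y → space (wedgeGraph G v H w) := Quot.lift g (by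
    rintro _ _ ⟨rfl, rfl⟩
    exact (hiff x y).2 ⟨rfl, rfl⟩)
  have hg' : Continuous g' := continuous_quot_lift _ hg
  have hbij : Function.Bijective g' := by
    constructor
    · rintro ⟨a | a⟩ ⟨b | b⟩ h
      · exact congrArg (fun z => Quot.mk _ (Sum.inl z)) (e.injective (inlMap_injective h))
      · obtain ⟨rfl, rfl⟩ := (hiff a b).1 h
        exact Quot.sound ⟨rfl, rfl⟩
      · obtain ⟨rfl, rfl⟩ := (hiff b a).1 h.symm
        exact (Quot.sound ⟨rfl, rfl⟩).symm
      · exact congrArg (fun z => Quot.mk _ (Sum.inr z)) (f.injective (inrMap_injective h))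
    · intro z
      rcases exists_inlMap_or_inrMap z with ⟨t, rfl⟩ | ⟨t, rfl⟩
      · exact ⟨Quot.mk _ (.inl (e.symm t)), congrArg (inlMap G v H w) (e.apply_symm_apply t)⟩
      · exact ⟨Quot.mk _ (.inr (f.symm t)), congrArg (inrMap G v H w) (f.apply_symm_apply t)⟩
  -- A continuous bijection from a compact space to a Hausdorff space is a homeomorphism, so no
  -- inverse needs to be shown continuous.
  exact ⟨Continuous.homeoOfEquivCompactToT2 (f := Equiv.ofBijective g' hbij) hg'⟩

end Wedge

end SphereBouquet

open SphereBouquet ContinuousMap in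
theorem mainTheorem1 :
    (∀ d : ℕ,
      (GraphHomotopic (cycleComplement (3 * d + 3)) (crossPolytopeWedge d) ∧
        Nonempty (space (cycleComplement (3 * d + 3)) ≃ₕ
          Wedge (Sphere.base d) (Sphere.base d))) ∧
      (GraphHomotopic (cycleComplement (3 * d + 2)) (crossPolytope d) ∧
        Nonempty (space (cycleComplement (3 * d + 2)) ≃ₕ Sphere d)) ∧
      (GraphHomotopic (cycleComplement (3 * d + 4)) (crossPolytope d) ∧
        Nonempty (space (cycleComplement (3 * d + 4)) ≃ₕ Sphere d))) ∧
    (∀ n : ℕ, 2 ≤ n →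
      GraphHomotopic (cycleComplement (n + 3)) (suspension (cycleComplement n)) ∧
        Nonempty (space (cycleComplement (n + 3)) ≃ₕ
          space (suspension (cycleComplement n)))) := by
  refine ⟨fun d => ⟨?_, ?_, ?_⟩, fun n hn => ?_⟩
  · have h := FoldEquiv.cycleComplement_crossPolytopeWedge d
    obtain ⟨e⟩ := h.homotopyEquiv
    obtain ⟨f⟩ := nonempty_wedge_homeomorph (sphereHomeomorph d) (sphereHomeomorph d)
      (sphereHomeomorph_base d) (sphereHomeomorph_base d)
    exact ⟨h.graphHomotopic, ⟨e.trans f.symm.toHomotopyEquiv⟩⟩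
  · have h := FoldEquiv.cycleComplement_crossPolytope_two d
    obtain ⟨e⟩ := h.homotopyEquiv
    exact ⟨h.graphHomotopic, ⟨e.trans (sphereHomeomorph d).symm.toHomotopyEquiv⟩⟩
  · have h := FoldEquiv.cycleComplement_crossPolytope_four d
    obtain ⟨e⟩ := h.homotopyEquiv
    exact ⟨h.graphHomotopic, ⟨e.trans (sphereHomeomorph d).symm.toHomotopyEquiv⟩⟩
  · have h := cycleComplement_add_three n hn
    exact ⟨h.graphHomotopic, h.homotopyEquiv⟩
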